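/- Let $\mathbb K$ be $\mathbb R$ or $\mathbb C$, let $\Omega$ be an uncountable locally compact Polish space, and let $\kappa$ be any ordinal of cardinality $\mathfrak c=2^{\aleph_0}$. Write $\mathbf Z(f)=\{x\in\Omega: f(x)=0\}$ for $f\in C(\Omega)=C(\Omega,\mathbb K)$, and $\mathbf Z[\Omega]=\{\mathbf Z(f): f\in C(\Omega)\}$ for the family of zero sets. A *$z$-filter* on $\Omega$ is a non-empty proper subset of $\mathbf Z[\Omega]$ closed under finite intersections and under supersets in $\mathbf Z[\Omega]$; a $z$-filter $\mathcal P$ is *prime* if $Z_1\cup Z_2\notin\mathcal P$ whenever $Z_1,Z_2\in\mathbf Z[\Omega]\setminus\mathcal P$. Let $C_0(\Omega)$ be the ring of continuous functions $\Omega\to\mathbb K$ vanishing at infinity. A proper ideal $I$ of $C_0(\Omega)$ is a *prime $z$-ideal* if it is prime ($fg\in I$ implies $f\in I$ or $g\in I$) and $g\in I$ whenever $g\in C_0(\Omega)$, $f\in I$ and $\mathbf Z(f)\subseteq\mathbf Z(g)$. Then there exists a family $(\mathcal Q_\alpha)_{\alpha<\kappa}$ of prime $z$-filters on $\Omega$ that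 is a well-ordered increasing chain of order type $\kappa$, that is, $\mathcal Q_\alpha\subsetneq\mathcal Q_\beta$ whenever $\alpha<\beta<\kappa$. Furthermore, setting $$Q_\alpha=\{f\in C_0(\Omega): \mathbf Z(f)\in\mathcal Q_\alpha\}\qquad(\alpha<\kappa),$$ each $Q_\alpha$ is a prime $z$-ideal of $C_0(\Omega)$, and $(Q_\alpha)_{\alpha<\kappa}$ is also a well-ordered increasing chain of order type $\kappa$: $Q_\alpha\subsetneq Q_\beta$ whenever $\alpha<\beta<\kappa$. -/

import Mathlib

open scoped ZeroAtInfty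

universe u v

/-- `Z ⊆ Ω` is a zero set, i.e. `Z = {x | f x = 0}` for a continuous `f : Ω → 𝕜`. -/
def IsZeroSet (𝕜 : Type*) [RCLike 𝕜] {Ω : Type*} [TopologicalSpace Ω] (Z : Set Ω) : Prop :=
  ∃ f : C(Ω, 𝕜), Z = {x | f x = 0}

/-- A `z`-filter on `Ω`: a non-empty proper subfamily of the family of all zero sets, closed under
finite intersections and under zero supersets. -/
structure IsZFilter (𝕜 : Type*) [RCLike 𝕜] {Ω : Type*} [TopologicalSpace Ω]
    (F : Set (Set Ω)) : Prop where
  isZeroSet : ∀ Z ∈ F, IsZeroSet 𝕜 Z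
  nonempty : F.Nonempty
  proper : F ≠ {Z | IsZeroSet 𝕜 Z}
  inter_mem : ∀ Z₁ ∈ F, ∀ Z₂ ∈ F, Z₁ ∩ Z₂ ∈ F
  superset_mem : ∀ Z₁ ∈ F, ∀ Z₂, IsZeroSet 𝕜 Z₂ → Z₁ ⊆ Z₂ → Z₂ ∈ F

/-- A prime `z`-filter: the union of two zero sets that are not members is not a member. -/
structure IsPrimeZFilter (𝕜 : Type*) [RCLike 𝕜] {Ω : Type*} [TopologicalSpace Ω]
    (F : Set (Set Ω)) : Prop extends IsZFilter 𝕜 F where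
  union_notMem : ∀ Z₁ Z₂, IsZeroSet 𝕜 Z₁ → IsZeroSet 𝕜 Z₂ → Z₁ ∉ F → Z₂ ∉ F → Z₁ ∪ Z₂ ∉ F

/-- A prime `z`-ideal of the (commutative, possibly non-unital) ring `C₀(Ω, 𝕜)`: a proper prime
ideal `I` such that `g ∈ I` whenever the zero set of `g` contains the zero set of some `f ∈ I`. -/
structure IsPrimeZIdeal {𝕜 : Type*} [RCLike 𝕜] {Ω : Type*} [TopologicalSpace Ω]
    (I : TwoSidedIdeal C₀(Ω, 𝕜)) : Prop where
  ne_top : I ≠ ⊤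
  mem_or_mem : ∀ f g : C₀(Ω, 𝕜), f * g ∈ I → f ∈ I ∨ g ∈ I
  mem_of_zeroSet_subset : ∀ f g : C₀(Ω, 𝕜), f ∈ I → {x | f x = 0} ⊆ {x | g x = 0} → g ∈ I

/-!
Prime `z`-filters are obtained as traces of ultrafilters on the zero sets, and a chain of them is
indexed by any linear order `I` with at most continuum many elements. In the Cantor cube, attach to
`a : I` the closed set `Z a` of points vanishing on a set `B a ⊆ ℕ`, where the `B a` are infinite
and almost disjoint. Each point `x` of a finite intersection of the `Z a`, `a ∈ s`, is then a limit
of points of that intersection lying outside `Z b`, for any other `b`. If `b > max s`, a limit along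
an ultrafilter of chains based at such points, continued by the principal ultrafilter at `x` at the
indices above `b`, is a chain in which `Z a` appears precisely above `a` for `a ∈ s ∪ {b}`. A
further ultrafilter limit over all finite `s` handles all of `I` at once. Finally the chain is
pushed forward along an embedding of the Cantor cube in `Ω`. It stays strict, even on zero sets of
`C₀` functions, because a continuous function on a compact subspace extends to one in `C₀`.
-/

open Filter Function Topology

section UltrafilterChain

variable {ι I X : Type*}

theorem mem_bind_iff_of_eventually {W : Ultrafilter ι} {U : ι → Ultrafilter X} {A : Set X}
    {p : Prop} (h : ∀ᶠ i in W, A ∈ U i ↔ p) : A ∈ W.bind U ↔ p :=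
  (eventually_congr h).trans eventually_const

theorem monotone_mem_bind [Preorder I] {W : Ultrafilter ι} {U : ι → I → Ultrafilter X} {A : Set X}
    (h : ∀ᶠ i in W, Monotone (A ∈ U i ·)) : Monotone fun β ↦ A ∈ W.bind (U · β) :=
  fun _ _ hβγ (hA : ∀ᶠ i in W, A ∈ U i _) ↦ (h.and hA).mono fun _ hi ↦ hi.1 hβγ hi.2

variable [TopologicalSpace X]

theorem bind_le_nhds {W : Ultrafilter X} {U : X → Ultrafilter X} {x : X} (hW : ↑W ≤ 𝓝 x)
    (hU : ∀ᶠ y in W, ↑(U y) ≤ 𝓝 y) : ↑(W.bind U) ≤ 𝓝 x := by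
  intro A hA
  have hAW : ∀ᶠ y in W, A ∈ 𝓝 y := hW (eventually_mem_nhds_iff.2 hA)
  exact (hU.and hAW).mono fun y hy ↦ hy.1 hy.2

theorem monotone_mem_ite_pure [Preorder I] [DecidableLT I] {U : I → Ultrafilter X} {x : X}
    (hU : ∀ β, ↑(U β) ≤ 𝓝 x) {A : Set X} (hA : IsClosed A) (hmono : Monotone (A ∈ U ·)) (b : I) :
    Monotone fun β ↦ A ∈ if b < β then pure x else U β := by
  intro β γ hβγ hAβ
  split_ifs at hAβ ⊢ with hγ hβ hβ
  · exact hAβ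
  · exact isClosed_iff_ultrafilter.1 hA x (U β) (hU β) hAβ
  · exact absurd (hβ.trans_le hβγ) hγ
  · exact hmono hβγ hAβ

variable [LinearOrder I] {Z : I → Set X}

theorem exists_ultrafilter_chain_finset (hZ : ∀ a, IsClosed (Z a))
    (hd : ∀ (s : Finset I) (b : I), b ∉ s → (⋂ a ∈ s, Z a) ⊆ closure ((⋂ a ∈ s, Z a) \ Z b))
    (s : Finset I) : ∀ x ∈ ⋂ a ∈ s, Z a, ∃ U : I → Ultrafilter X,
      (∀ β, ↑(U β) ≤ 𝓝 x) ∧ (∀ A, IsClosed A → Monotone (A ∈ U ·)) ∧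
      ∀ a ∈ s, ∀ β, Z a ∈ U β ↔ a < β := by
  induction s using Finset.induction_on_max with
  | empty =>
    exact fun x _ ↦
      ⟨fun _ ↦ pure x, fun _ ↦ pure_le_nhds x, fun _ _ ↦ monotone_const, by simp⟩
  | insert b s hb ih =>
    intro x hx
    obtain ⟨hxb, hxs⟩ : x ∈ Z b ∧ x ∈ ⋂ a ∈ s, Z a := by
      rwa [Finset.set_biInter_insert] at hx
    obtain ⟨W, hW, hWx⟩ := mem_closure_iff_ultrafilter.1 (hd s b (fun h ↦ (hb b h).false) hxs)
    have : Nonempty X := ⟨x⟩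
    choose! V hVnhds hVmono hVsep using ih
    have hWs : ∀ᶠ y in W, y ∈ ⋂ a ∈ s, Z a := mem_of_superset hW Set.sdiff_subset
    have hlim (β) : ↑(W.bind (V · β)) ≤ 𝓝 x :=
      bind_le_nhds hWx (hWs.mono fun y hy ↦ hVnhds y hy β)
    have hsep (a) (ha : a ∈ s) (β) : Z a ∈ W.bind (V · β) ↔ a < β :=
      mem_bind_iff_of_eventually (hWs.mono fun y hy ↦ hVsep y hy a ha β)
    have hnotMem (β) : Z b ∉ W.bind (V · β) := by
      intro (h : ∀ᶠ y in W, Z b ∈ V y β)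
      obtain ⟨y, hyZ, hys, hyb⟩ := (h.and hW).exists
      exact hyb (isClosed_iff_ultrafilter.1 (hZ b) y _ (hVnhds y hys β) hyZ)
    refine ⟨fun β ↦ if b < β then pure x else W.bind (V · β), fun β ↦ ?_, fun A hA ↦ ?_,
      fun a ha β ↦ ?_⟩
    · dsimp only
      split_ifs
      exacts [pure_le_nhds x, hlim β]
    · exact monotone_mem_ite_pure hlim hA
        (monotone_mem_bind (hWs.mono fun y hy ↦ hVmono y hy A hA)) b
    · dsimp only
      split_ifs with hβ <;> obtain rfl | ha := Finset.mem_insert.1 ha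
      · exact iff_of_true hxb hβ
      · exact iff_of_true (Set.mem_iInter₂.1 hxs a ha) ((hb a ha).trans hβ)
      · exact iff_of_false (hnotMem β) hβ
      · exact hsep a ha β

theorem exists_ultrafilter_chain (hZ : ∀ a, IsClosed (Z a)) (hne : (⋂ a, Z a).Nonempty)
    (hd : ∀ (s : Finset I) (b : I), b ∉ s → (⋂ a ∈ s, Z a) ⊆ closure ((⋂ a ∈ s, Z a) \ Z b)) :
    ∃ U : I → Ultrafilter X, (∀ A, IsClosed A → Monotone (A ∈ U ·)) ∧
      ∀ a β, Z a ∈ U β ↔ a < β := by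
  obtain ⟨x, hx⟩ := hne
  choose V _ hVmono hVsep using fun s : Finset I ↦ exists_ultrafilter_chain_finset hZ hd s x
    (Set.mem_iInter₂.2 fun a _ ↦ Set.mem_iInter.1 hx a)
  let W : Ultrafilter (Finset I) := Ultrafilter.of atTop
  have hW (a : I) : ∀ᶠ s : Finset I in W, a ∈ s := Ultrafilter.of_le atTop <|
    (eventually_ge_atTop {a}).mono fun _ ↦ Finset.singleton_subset_iff.1
  exact ⟨fun β ↦ W.bind (V · β),
    fun A hA ↦ monotone_mem_bind (.of_forall fun s ↦ hVmono s A hA),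
    fun a β ↦ mem_bind_iff_of_eventually ((hW a).mono fun s hs ↦ hVsep s a hs β)⟩

end UltrafilterChain

section AlmostDisjoint

theorem infinite_sdiff_biUnion_of_almostDisjoint {I J : Type*} {B : I → Set J}
    (hB : ∀ a, (B a).Infinite) (hdisj : Pairwise fun a b ↦ (B a ∩ B b).Finite)
    {s : Finset I} {b : I} (hb : b ∉ s) : (B b \ ⋃ a ∈ s, B a).Infinite := by
  rw [← Set.sdiff_self_inter, Set.inter_iUnion₂]
  exact (hB b).sdiff (s.finite_toSet.biUnion fun a ha ↦ hdisj (ne_of_mem_of_not_mem ha hb).symm)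

/-- The branch of the binary tree along `t`, a set of (codes of) finite binary words. Distinct
branches form an almost disjoint family of continuum many sets of natural numbers. -/
def branch (t : ℕ → Bool) : Set ℕ :=
  Set.range fun n ↦ Encodable.encode (PiNat.res t n)

theorem infinite_branch (t : ℕ → Bool) : (branch t).Infinite :=
  Set.infinite_range_of_injective <| Encodable.encode_injective.comp fun m n h ↦ by
    simpa only [PiNat.res_length] using congrArg List.length h

theorem pairwise_finite_branch_inter : Pairwise fun t u ↦ (branch t ∩ branch u).Finite := by
  intro t u htu
  obtain ⟨k, hk⟩ := Function.ne_iff.1 htu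
  refine ((Set.finite_Iic k).image fun n ↦ Encodable.encode (PiNat.res t n)).subset ?_
  rintro _ ⟨⟨n, rfl⟩, m, hm⟩
  have hres : PiNat.res u m = PiNat.res t n := Encodable.encode_injective hm
  obtain rfl : m = n := by simpa only [PiNat.res_length] using congrArg List.length hres
  exact ⟨m, le_of_not_gt fun hkm ↦ hk (PiNat.res_eq_res.1 hres hkm).symm, rfl⟩

end AlmostDisjoint

section VanishingSet

variable {I J : Type*}

/-- The closed set of points of the Cantor cube `J → Bool` whose coordinates in `B` are all zero. -/
def vanishingSet (B : Set J) : Set (J → Bool) :=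
  {x | ∀ j ∈ B, x j = false}

theorem isClosed_vanishingSet (B : Set J) : IsClosed (vanishingSet B) := by
  simp only [vanishingSet, Set.ofPred_forall]
  exact isClosed_biInter fun j _ ↦ isClosed_eq (continuous_apply j) continuous_const

theorem tendsto_update_cofinite [DecidableEq J] {M : J → Type*} [∀ j, TopologicalSpace (M j)]
    (x y : ∀ j, M j) : Tendsto (fun j ↦ update x j (y j)) cofinite (𝓝 x) :=
  tendsto_pi_nhds.2 fun i ↦ tendsto_const_nhds.congr' <|
    (eventually_cofinite_ne i).mono fun _ hj ↦ (update_of_ne hj.symm _ _).symm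

theorem biInter_vanishingSet_subset_closure_sdiff {B : I → Set J} {s : Finset I} {b : I}
    (hB : (B b \ ⋃ a ∈ s, B a).Infinite) :
    (⋂ a ∈ s, vanishingSet (B a)) ⊆
      closure ((⋂ a ∈ s, vanishingSet (B a)) \ vanishingSet (B b)) := by
  classical
  intro x hx
  refine mem_closure_of_frequently_of_tendsto
    ((frequently_cofinite_mem_iff_infinite.2 hB).mono fun j ⟨hjb, hjs⟩ ↦ ⟨?_, fun h ↦ ?_⟩)
    (tendsto_update_cofinite x fun _ ↦ true)
  · simp only [Set.mem_iUnion, not_exists] at hjs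
    refine Set.mem_iInter₂.2 fun a ha i hi ↦ ?_
    rw [update_of_ne (ne_of_mem_of_not_mem hi (hjs a ha))]
    exact Set.mem_iInter₂.1 hx a ha i hi
  · simpa using h j hjb

end VanishingSet

section ZeroAtInfty

variable {𝕜 : Type*} [RCLike 𝕜] {X Ω : Type*} [TopologicalSpace X] [CompactSpace X]
  [TopologicalSpace Ω] [T2Space Ω] [LocallyCompactSpace Ω] {e : X → Ω}

theorem exists_zeroAtInfty_comp_eq (he : Continuous e) (hinj : Injective e) (f : C(X, 𝕜)) :
    ∃ g : C₀(Ω, 𝕜), g ∘ e = f := by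
  -- Apply Tietze in the one-point compactification, prescribing the value `0` at `∞` as well.
  let e' : X ⊕ Unit → OnePoint Ω := Sum.elim (fun x ↦ e x) fun _ ↦ OnePoint.infty
  have he' : IsClosedEmbedding e' := by
    refine Continuous.isClosedEmbedding
      ((OnePoint.continuous_coe.comp he).sumElim continuous_const) ?_
    exact (OnePoint.coe_injective.comp hinj).sumElim (injective_of_subsingleton _)
      fun x _ ↦ OnePoint.coe_ne_infty (e x)
  obtain ⟨G, hG⟩ := (ContinuousMap.mk (Sum.elim f 0)
    (f.continuous.sumElim continuous_const)).exists_extension' he'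
  have hG₀ : G OnePoint.infty = 0 := congrFun hG (Sum.inr ())
  refine ⟨⟨G.comp ⟨_, OnePoint.continuous_coe⟩, ?_⟩, funext fun x ↦ congrFun hG (Sum.inl x)⟩
  rw [← coclosedCompact_eq_cocompact, ← hG₀]
  exact (G.continuous.tendsto _).comp OnePoint.tendsto_coe_infty

theorem exists_zeroAtInfty_preimage_zeroSet_eq [PerfectlyNormalSpace X] (he : Continuous e)
    (hinj : Injective e) {Z : Set X} (hZ : IsClosed Z) :
    ∃ g : C₀(Ω, 𝕜), e ⁻¹' {x | g x = 0} = Z := by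
  obtain ⟨f, rfl, -⟩ := perfectlyNormalSpace_iff_forall_isClosed_preimage_zero.1 ‹_› Z hZ
  obtain ⟨g, hg⟩ := exists_zeroAtInfty_comp_eq he hinj
    ((⟨_, RCLike.continuous_ofReal⟩ : C(ℝ, 𝕜)).comp f)
  refine ⟨g, Set.ext fun x ↦ ?_⟩
  have hgx : g (e x) = (f x : 𝕜) := congrFun hg x
  simp only [Set.mem_preimage, Set.mem_ofPred_eq, hgx, RCLike.ofReal_eq_zero,
    Set.mem_singleton_iff]

end ZeroAtInfty

section ZFilter

variable {𝕜 : Type*} [RCLike 𝕜] {Ω : Type*} [TopologicalSpace Ω]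

theorem isZeroSet_zeroAtInfty (f : C₀(Ω, 𝕜)) : IsZeroSet 𝕜 {x | f x = 0} :=
  ⟨f.toContinuousMap, rfl⟩

theorem IsZeroSet.isClosed {Z : Set Ω} (hZ : IsZeroSet 𝕜 Z) : IsClosed Z := by
  obtain ⟨f, rfl⟩ := hZ
  exact isClosed_eq f.continuous continuous_const

theorem IsZeroSet.inter {Z₁ Z₂ : Set Ω} (h₁ : IsZeroSet 𝕜 Z₁) (h₂ : IsZeroSet 𝕜 Z₂) :
    IsZeroSet 𝕜 (Z₁ ∩ Z₂) := by
  obtain ⟨f, rfl⟩ := h₁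
  obtain ⟨g, rfl⟩ := h₂
  refine ⟨⟨fun x ↦ ((‖f x‖ + ‖g x‖ : ℝ) : 𝕜), by fun_prop⟩, ?_⟩
  ext x
  have : ‖f x‖ + ‖g x‖ = 0 ↔ f x = 0 ∧ g x = 0 := by
    rw [add_eq_zero_iff_of_nonneg (norm_nonneg _) (norm_nonneg _), norm_eq_zero, norm_eq_zero]
  exact (RCLike.ofReal_eq_zero.trans this).symm

/-- The trace of an ultrafilter on the lattice of zero sets; it is a prime `z`-filter. -/
def zTrace (𝕜 : Type*) [RCLike 𝕜] (U : Ultrafilter Ω) : Set (Set Ω) :=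
  {Z | IsZeroSet 𝕜 Z ∧ Z ∈ U}

theorem isPrimeZFilter_zTrace (U : Ultrafilter Ω) : IsPrimeZFilter 𝕜 (zTrace 𝕜 U) where
  isZeroSet _ hZ := hZ.1
  nonempty := ⟨Set.univ, ⟨0, by simp⟩, univ_mem⟩
  proper h := by
    have hempty : IsZeroSet 𝕜 (∅ : Set Ω) := ⟨1, by simp⟩
    exact U.empty_notMem (h.ge hempty).2
  inter_mem _ h₁ _ h₂ := ⟨h₁.1.inter h₂.1, inter_mem h₁.2 h₂.2⟩
  superset_mem _ h₁ _ h₂ hsub := ⟨h₂, mem_of_superset h₁.2 hsub⟩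
  union_notMem _ _ h₁ h₂ hn₁ hn₂ h :=
    (Ultrafilter.union_mem_iff.1 h.2).elim (fun h' ↦ hn₁ ⟨h₁, h'⟩) fun h' ↦ hn₂ ⟨h₂, h'⟩

theorem zeroSet_mem_zTrace_iff {U : Ultrafilter Ω} {f : C₀(Ω, 𝕜)} :
    {x | f x = 0} ∈ zTrace 𝕜 U ↔ {x | f x = 0} ∈ U :=
  and_iff_right (isZeroSet_zeroAtInfty f)

variable {F G : Set (Set Ω)}

theorem IsZFilter.zeroSet_mem_of_subset (hF : IsZFilter 𝕜 F) {Z : Set Ω} (hZ : Z ∈ F)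
    {f : C₀(Ω, 𝕜)} (h : Z ⊆ {x | f x = 0}) : {x | f x = 0} ∈ F :=
  hF.superset_mem Z hZ _ (isZeroSet_zeroAtInfty f) h

/-- The ideal of `C₀(Ω, 𝕜)` of the functions whose zero set belongs to a given `z`-filter. -/
def IsZFilter.ideal (hF : IsZFilter 𝕜 F) : TwoSidedIdeal C₀(Ω, 𝕜) :=
  TwoSidedIdeal.mk' {f | {x | f x = 0} ∈ F}
    (hF.zeroSet_mem_of_subset hF.nonempty.some_mem fun _ _ ↦ rfl)
    (fun {f g} hf hg ↦ hF.zeroSet_mem_of_subset (hF.inter_mem _ hf _ hg)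
      fun x ⟨(hfx : f x = 0), (hgx : g x = 0)⟩ ↦ by simp [hfx, hgx])
    (fun {f} hf ↦ hF.zeroSet_mem_of_subset hf fun x (hx : f x = 0) ↦ by simp [hx])
    (fun {f g} hg ↦ hF.zeroSet_mem_of_subset hg fun x (hx : g x = 0) ↦ by simp [hx])
    (fun {f g} hf ↦ hF.zeroSet_mem_of_subset hf fun x (hx : f x = 0) ↦ by simp [hx])

theorem IsZFilter.mem_ideal (hF : IsZFilter 𝕜 F) {f : C₀(Ω, 𝕜)} :
    f ∈ hF.ideal ↔ {x | f x = 0} ∈ F := by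
  simp only [IsZFilter.ideal, TwoSidedIdeal.mem_mk', Set.mem_ofPred_eq]

theorem IsPrimeZFilter.isPrimeZIdeal_ideal (hF : IsPrimeZFilter 𝕜 F)
    (hproper : ∃ f : C₀(Ω, 𝕜), {x | f x = 0} ∉ F) : IsPrimeZIdeal hF.toIsZFilter.ideal where
  ne_top h := by
    obtain ⟨f, hf⟩ := hproper
    exact hf (hF.mem_ideal.1 (h ▸ trivial))
  mem_or_mem f g hfg := by
    have hmul : {x | (f * g) x = 0} = {x | f x = 0} ∪ {x | g x = 0} :=
      Set.ext fun x ↦ mul_eq_zero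
    rw [hF.mem_ideal, hmul] at hfg
    simp only [hF.mem_ideal]
    by_contra! hn
    exact hF.union_notMem _ _ (isZeroSet_zeroAtInfty f) (isZeroSet_zeroAtInfty g) hn.1 hn.2 hfg
  mem_of_zeroSet_subset _ _ hf hsub :=
    hF.mem_ideal.2 (hF.zeroSet_mem_of_subset (hF.mem_ideal.1 hf) hsub)

theorem IsZFilter.ideal_lt_ideal (hF : IsZFilter 𝕜 F) (hG : IsZFilter 𝕜 G) (hFG : F ⊆ G)
    {f : C₀(Ω, 𝕜)} (hfG : {x | f x = 0} ∈ G) (hfF : {x | f x = 0} ∉ F) : hF.ideal < hG.ideal :=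
  SetLike.lt_iff_le_and_exists.2 ⟨fun _ hg ↦ hG.mem_ideal.2 (hFG (hF.mem_ideal.1 hg)),
    f, hG.mem_ideal.2 hfG, fun hf ↦ hfF (hF.mem_ideal.1 hf)⟩

end ZFilter

section Chain

variable (𝕜 : Type*) [RCLike 𝕜] {Ω : Type*} [TopologicalSpace Ω] [T2Space Ω]
  [LocallyCompactSpace Ω] {I : Type*} [LinearOrder I]

theorem exists_ultrafilter_chain_zeroAtInfty {e : (ℕ → Bool) → Ω} (he : Continuous e)
    (hinj : Injective e) (hI : Cardinal.mk I ≤ Cardinal.continuum) :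
    ∃ (U : I → Ultrafilter Ω) (g : I → C₀(Ω, 𝕜)),
      (∀ A, IsClosed A → Monotone (A ∈ U ·)) ∧ ∀ a β, {x | g a x = 0} ∈ U β ↔ a < β := by
  obtain ⟨t⟩ : Nonempty (I ↪ (ℕ → Bool)) := Cardinal.lift_mk_le'.1 (by simpa using hI)
  have hdisj : Pairwise fun a b ↦ (branch (t a) ∩ branch (t b)).Finite :=
    pairwise_finite_branch_inter.comp_of_injective t.injective
  obtain ⟨V, hVmono, hVsep⟩ := exists_ultrafilter_chain
    (fun a ↦ isClosed_vanishingSet (branch (t a)))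
    ⟨fun _ ↦ false, Set.mem_iInter.2 fun _ _ _ ↦ rfl⟩
    (fun s b hb ↦ biInter_vanishingSet_subset_closure_sdiff <|
      infinite_sdiff_biUnion_of_almostDisjoint (fun a ↦ infinite_branch (t a)) hdisj hb)
  choose g hg using fun a ↦ exists_zeroAtInfty_preimage_zeroSet_eq (𝕜 := 𝕜) he hinj
    (isClosed_vanishingSet (branch (t a)))
  refine ⟨fun β ↦ (V β).map e, g, fun A hA ↦ hVmono _ (hA.preimage he), fun a β ↦ ?_⟩
  rw [Ultrafilter.mem_map, hg]
  exact hVsep a β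

theorem theorem5p6_general {e : (ℕ → Bool) → Ω} (he : Continuous e) (hinj : Injective e)
    (hI : Cardinal.mk I ≤ Cardinal.continuum) :
    ∃ Q : I → Set (Set Ω),
      (∀ α, IsPrimeZFilter 𝕜 (Q α)) ∧ StrictMono Q ∧
      ∃ P : I → TwoSidedIdeal C₀(Ω, 𝕜),
        (∀ α f, f ∈ P α ↔ {x | f x = 0} ∈ Q α) ∧
        (∀ α, IsPrimeZIdeal (P α)) ∧ StrictMono P := by
  obtain ⟨U, g, hmono, hsep⟩ := exists_ultrafilter_chain_zeroAtInfty 𝕜 he hinj hI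
  have hQ (α) : IsPrimeZFilter 𝕜 (zTrace 𝕜 (U α)) := isPrimeZFilter_zTrace (U α)
  have hle {α β} (h : α < β) : zTrace 𝕜 (U α) ⊆ zTrace 𝕜 (U β) :=
    fun Z hZ ↦ ⟨hZ.1, hmono Z hZ.1.isClosed h.le hZ.2⟩
  have hmem {α β} (h : α < β) : {x | g α x = 0} ∈ zTrace 𝕜 (U β) :=
    zeroSet_mem_zTrace_iff.2 ((hsep α β).2 h)
  have hnotMem (α) : {x | g α x = 0} ∉ zTrace 𝕜 (U α) :=
    fun h ↦ lt_irrefl α ((hsep α α).1 (zeroSet_mem_zTrace_iff.1 h))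
  exact ⟨fun α ↦ zTrace 𝕜 (U α), hQ,
    fun α β h ↦ Set.ssubset_iff_exists.2 ⟨hle h, _, hmem h, hnotMem α⟩,
    fun α ↦ (hQ α).ideal, fun α _ ↦ (hQ α).mem_ideal,
    fun α ↦ (hQ α).isPrimeZIdeal_ideal ⟨g α, hnotMem α⟩,
    fun α β h ↦ (hQ α).ideal_lt_ideal (hQ β).toIsZFilter (hle h) (hmem h) (hnotMem α)⟩

end Chain

theorem theorem5p6 (𝕜 : Type*) [RCLike 𝕜] (Ω : Type u) [TopologicalSpace Ω] [PolishSpace Ω]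
    [LocallyCompactSpace Ω] [Uncountable Ω] (κ : Ordinal.{v}) (hκ : κ.card = Cardinal.continuum) :
    ∃ Q : Set.Iio κ → Set (Set Ω),
      (∀ α, IsPrimeZFilter 𝕜 (Q α)) ∧ StrictMono Q ∧
      ∃ P : Set.Iio κ → TwoSidedIdeal C₀(Ω, 𝕜),
        (∀ α f, f ∈ P α ↔ {x | f x = 0} ∈ Q α) ∧
        (∀ α, IsPrimeZIdeal (P α)) ∧ StrictMono P := by
  obtain ⟨e, -, he, hinj⟩ := (isClosed_univ (X := Ω)).exists_nat_bool_injection_of_not_countable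
    Set.not_countable_univ
  exact theorem5p6_general 𝕜 he hinj (by simp [Cardinal.mk_Iio_ordinal, hκ])
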